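/- **Setting.** Let $n\ge 1$. A *nested clustering* of $n$ nodes consists of integers $1\le L\le K\le n$ and clustering functions $z:\{1,\dots,n\}\to\{1,\dots,K\}$ (nodes to communities) and $c:\{1,\dots,K\}\to\{1,\dots,L\}$ (communities to meta-communities), equivalently of clustering matrices $Z$ and $C$. For an $n\times n$ matrix $M$ let $M^{(l,k)}(Z,C)$ be its block column with rows $\{i: c(z(i))=l\}$ and columns $\{j: z(j)=k\}$. For a matrix $X$ let $\Pi_{(1)}(X)$ be a best approximation of $X$ in the Frobenius norm by matrices of rank at most one (any one, if there are several). *Model.* $P_*\in[0,1]^{n\times n}$ is a symmetric matrix that follows a Nested Block Model with nested clustering $(K_*,L_*,z_*,c_*)$: with $n_k=\#\{i:z_*(i)=k\}$, $B_{k_1,k_2}=\frac1{n_{k_1}n_{k_2}}\sum_{z_*(i)=k_1,\,z_*(j)=k_2}(P_*)_{i,j}$, and a matrix $H\in\mathbb R_+^{n\times L_*}$ with sub-vectors $h^{(k,l)}=(H_{i,l})_{z_*(i)=k}$ satisfying $\sum_{z_*(i)=k}H_{i,l}=n_k$, the $(k_1,k_2)$-th block of $P_*$ is $B_{k_1,k_2}\,h^{(k_1,c_*(k_2))}\bigl(h^{(k_2,c_*(k_1))}\bigr)^T$.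 Assume: * A1: the smallest singular value of $B$ is at least some $\lambda_0>0$; * A2: for each $k=1,\dots,K_*$ the vectors $h^{(k,l)}$, $l=1,\dots,L_*$, are linearly independent. The adjacency matrix $A\in\{0,1\}^{n\times n}$ is a symmetric random matrix whose entries $A_{i,j}$, $i<j$, are independent with $A_{i,j}\sim\mathrm{Bernoulli}((P_*)_{i,j})$; the diagonal entries are arbitrary (in particular they may all be $0$). *Estimator.* For constants $\Psi_1,\Psi_2,\Psi_3>0$ put $\mathrm{Pen}(n,K,L)=\Psi_1nK+\Psi_2K^2\ln n+\Psi_3n\ln K$, and let $$(\hat Z,\hat C,\hat K,\hat L)\in\operatorname*{argmin}_{Z,C,K,L}\Bigl\{\sum_{l=1}^{L}\sum_{k=1}^{K}\bigl\|A^{(l,k)}(Z,C)-\Pi_{(1)}\bigl(A^{(l,k)}(Z,C)\bigr)\bigr\|_F^2+\mathrm{Pen}(n,K,L)\Bigr\},$$ the minimum being over all nested clusterings of the $n$ nodes. Let $\hat P$ be the (measurable) random $n\times n$ matrix whose block columns are $\hat P^{(l,k)}(\hat Z,\hat C)=\Pi_{(1)}\bigl(A^{(l,k)}(\hat Z,\hat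 C)\bigr)$, $l=1,\dots,\hat L$, $k=1,\dots,\hat K$. **Theorem.** There is an absolute constant $\Psi_0>0$ such that for all $\Psi_1,\Psi_2,\Psi_3\ge\Psi_0$ there is a constant $\tilde C=\tilde C(\Psi_1,\Psi_2,\Psi_3)>0$, depending on nothing else (not on $n$, $P_*$, $K_*$, $L_*$, $\lambda_0$), such that in the above setting, for every $t>0$, $$\mathbb P\Bigl\{\|\hat P-P_*\|_F^2\le\tilde C\,[\mathrm{Pen}(n,K_*,L_*)+t]\Bigr\}\ge1-3e^{-t},$$ and $\|\hat P-P_*\|_F^2$ is integrable with $$\mathbb E\|\hat P-P_*\|_F^2\le\tilde C\,[\mathrm{Pen}(n,K_*,L_*)+3].$$ -/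

import Mathlib

open MeasureTheory ProbabilityTheory

/-! The norm `‖M‖` of a real matrix `M` is the Frobenius norm. -/
attribute [local instance] Matrix.frobeniusNormedAddCommGroup

noncomputable section

/-- A nested clustering of the nodes `Fin n`: a clustering function `z` of the `n` nodes into
`K ≤ n` communities and a clustering function `c` of the `K` communities into `L ≤ K`
meta-communities. -/
structure NestedClustering (n : ℕ) where
  /-- number of communities -/
  K : ℕ
  /-- number of meta-communities -/
  L : ℕ
  one_le_K : 1 ≤ K
  K_le : K ≤ n
  one_le_L : 1 ≤ L
  L_le : L ≤ K
  /-- clustering function of the nodes -/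
  z : Fin n → Fin K
  /-- clustering function of the communities -/
  c : Fin K → Fin L

namespace NestedClustering

variable {n : ℕ}

/-- The number `n_k` of nodes in community `k`. -/
def size (S : NestedClustering n) (k : Fin S.K) : ℕ :=
  Fintype.card {i : Fin n // S.z i = k}

/-- The matrix `B` of average connection probabilities between communities,
`B k₁ k₂ = (n_{k₁} n_{k₂})⁻¹ ∑_{z i = k₁, z j = k₂} P i j`. -/
def blockMeans (S : NestedClustering n) (P : Matrix (Fin n) (Fin n) ℝ) :
    Matrix (Fin S.K) (Fin S.K) ℝ :=
  Matrix.of fun k₁ k₂ =>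
    (∑ i : {i : Fin n // S.z i = k₁}, ∑ j : {j : Fin n // S.z j = k₂}, P i j) /
      ((S.size k₁ : ℝ) * (S.size k₂ : ℝ))

/-- The block column `M^{(l,k)}` of `M`: its rows are the nodes of meta-community `l` and its
columns are the nodes of community `k`. -/
def blockColumn (S : NestedClustering n) (M : Matrix (Fin n) (Fin n) ℝ)
    (l : Fin S.L) (k : Fin S.K) :
    Matrix {i : Fin n // S.c (S.z i) = l} {j : Fin n // S.z j = k} ℝ :=
  M.submatrix Subtype.val Subtype.val

end NestedClustering

/-- `P` is the matrix of connection probabilities of a Nested Block Model with (meta-)communities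
`S` and degree weights `H`. The column `H_l` of `H` consists of the sub-vectors
`h^{(k,l)} = (H i l)_{z i = k}`, and the `(k₁,k₂)`-th block of `P` is
`B k₁ k₂ • h^{(k₁, c k₂)} (h^{(k₂, c k₁)})ᵀ`. -/
structure IsNestedBlockModel {n : ℕ} (S : NestedClustering n) (P : Matrix (Fin n) (Fin n) ℝ)
    (H : Matrix (Fin n) (Fin S.L) ℝ) : Prop where
  prob_mem : ∀ i j, P i j ∈ Set.Icc (0 : ℝ) 1
  symm : P.IsSymm
  weight_nonneg : ∀ i l, 0 ≤ H i l
  scaling : ∀ (k : Fin S.K) (l : Fin S.L),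
    ∑ i : {i : Fin n // S.z i = k}, H i l = (S.size k : ℝ)
  blocks : ∀ i j, P i j =
    S.blockMeans P (S.z i) (S.z j) * (H i (S.c (S.z j)) * H j (S.c (S.z i)))

/-- Assumption A1 with the constant `lam0`: the smallest singular value of the `K × K` matrix `B`
of block averages (the last one, singular values being listed in decreasing order from index `0`)
is at least `lam0`. -/
def AssumptionA1 {n : ℕ} (S : NestedClustering n) (P : Matrix (Fin n) (Fin n) ℝ)
    (lam0 : ℝ) : Prop :=
  lam0 ≤ (Matrix.toEuclideanLin (S.blockMeans P)).singularValues (S.K - 1)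

/-- Assumption A2: for each community `k` the vectors `h^{(k,l)}`, `l = 1, …, L`, are linearly
independent. -/
def AssumptionA2 {n : ℕ} (S : NestedClustering n) (H : Matrix (Fin n) (Fin S.L) ℝ) : Prop :=
  ∀ k : Fin S.K,
    LinearIndependent ℝ (fun (l : Fin S.L) (i : {i : Fin n // S.z i = k}) => H i l)

/-- `A` is the random adjacency matrix of an undirected network with matrix of connection
probabilities `P`: a symmetric random matrix with entries in `{0, 1}`, whose entries `A i j`,
`i < j`, are independent with `A i j ∼ Bernoulli (P i j)`.
Nothing is required of the diagonal entries beyond being `0` or `1`, so that both the networks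
without self-loops (`A i i = 0`) and those with Bernoulli diagonal entries are included. -/
structure IsRandomAdjacency {n : ℕ} {Ω : Type*} [MeasurableSpace Ω] (μ : Measure Ω)
    (A : Ω → Matrix (Fin n) (Fin n) ℝ) (P : Matrix (Fin n) (Fin n) ℝ) : Prop where
  measurable : ∀ i j, Measurable fun ω => A ω i j
  zero_or_one : ∀ ω i j, A ω i j = 0 ∨ A ω i j = 1
  symm : ∀ ω, (A ω).IsSymm
  bernoulli : ∀ i j, i < j → μ {ω | A ω i j = 1} = ENNReal.ofReal (P i j)
  indep : iIndepFun
    (fun (e : {e : Fin n × Fin n // e.1 < e.2}) (ω : Ω) => A ω e.1.1 e.1.2) μ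

/-- `R` is a rank one projection `Π₍₁₎(M)` of `M`: a best approximation of `M` in the Frobenius
norm among the matrices of rank at most one. (It need not be unique if the largest singular value
of `M` is multiple.) -/
def IsRankOneProjection {m n : Type*} [Fintype m] [Fintype n] (M R : Matrix m n ℝ) : Prop :=
  R.rank ≤ 1 ∧ ∀ R' : Matrix m n ℝ, R'.rank ≤ 1 → ‖M - R‖ ≤ ‖M - R'‖

/-- `T` is the fit of `A` given the clustering `S`, with nodes in their original order: each of its
block columns is a rank one projection of the respective block column of `A`. -/
def IsRankOneFit {n : ℕ} (A : Matrix (Fin n) (Fin n) ℝ) (S : NestedClustering n)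
    (T : Matrix (Fin n) (Fin n) ℝ) : Prop :=
  ∀ (l : Fin S.L) (k : Fin S.K),
    IsRankOneProjection (S.blockColumn A l k) (S.blockColumn T l k)

/-- The penalty `Ψ₁ n K + Ψ₂ K² ln n + Ψ₃ n ln K`. (It does not depend on `L`.) -/
def penalty (Psi1 Psi2 Psi3 : ℝ) (n K _L : ℕ) : ℝ :=
  Psi1 * n * K + Psi2 * (K : ℝ) ^ 2 * Real.log n + Psi3 * n * Real.log K

/-- The penalized criterion of a clustering `S` with fit `T`: the sum of the squared Frobenius norms
of the residuals of the block columns plus the penalty. -/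
def criterion (Psi1 Psi2 Psi3 : ℝ) {n : ℕ} (A : Matrix (Fin n) (Fin n) ℝ)
    (S : NestedClustering n) (T : Matrix (Fin n) (Fin n) ℝ) : ℝ :=
  (∑ l : Fin S.L, ∑ k : Fin S.K, ‖S.blockColumn A l k - S.blockColumn T l k‖ ^ 2) +
    penalty Psi1 Psi2 Psi3 n S.K S.L

/-- `(S, T)` is a solution of the penalized optimization problem for the data `A`: `T` is the
block-wise rank one fit for `S`, and `S` minimizes the penalized criterion over all numbers of
communities `1 ≤ K ≤ n` and of meta-communities `1 ≤ L ≤ K` and all clusterings. -/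
def IsPenalizedEstimator (Psi1 Psi2 Psi3 : ℝ) {n : ℕ} (A : Matrix (Fin n) (Fin n) ℝ)
    (S : NestedClustering n) (T : Matrix (Fin n) (Fin n) ℝ) : Prop :=
  IsRankOneFit A S T ∧
    ∀ (S' : NestedClustering n) (T' : Matrix (Fin n) (Fin n) ℝ), IsRankOneFit A S' T' →
      criterion Psi1 Psi2 Psi3 A S T ≤ criterion Psi1 Psi2 Psi3 A S' T'

end

/-!
Comparing the criterion at the estimator with its value at the true clustering, whose block columns
of `P` have rank at most one, gives the basic inequality
`‖T - P‖² ≤ 2 ⟨A - P, T - P⟩ + Pen(K*) - Pen(K)` (`IsPenalizedEstimator.norm_sub_sq_le`), where `T`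
is the estimate and `K` the selected number of communities. So the noise has to be bounded in the
direction `T - P`, uniformly over all clusterings, by a level whose square is of the order `n K + t`:
the penalty `Ψ₁ n K` of the selected clustering then absorbs it (`norm_sub_sq_le_of_noise_le`).
The term `Ψ₁ n K` also covers the choice of the clustering: the number of clusterings into `K`
communities and at most `K` meta-communities, counted on the nodes, is at most
`K ^ (2 n) ≤ exp (2 n K)`.

For a fixed clustering, the matrices whose block columns have rank at most one are given by two
factors with `n K` entries each (`nestedRankOne`). Rounding normalized factors to integer multiples
of a small mesh yields a net with `exp (O (n K))` elements (`card_intBall_le`), and the rounding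
error is a sum of two smaller matrices of the same kind, so that a bound for a linear form on the net
extends to all of them at the cost of a factor `2` (`frobInner_nestedRankOne_le`). As `T - P` itself
is not of this kind, it is split as `(T - Q) + (Q - P)` with the best blockwise approximation `Q` of
`P`, which is not random; `T - Q` is an orthogonal sum of two matrices of rank one in each block
(`exists_orthogonal_split`), and `‖T - Q‖ ≤ 2 ‖T - P‖` (`frobInner_noise_sub_le`).

Linear forms of the off-diagonal noise are sub-Gaussian by Hoeffding's lemma, and a union bound over
the clusterings, their nets and the directions `Q - P` gives the exceptional probability `exp (-t)`
(`IsRandomAdjacency.measureReal_exists_lt_frobInner_noise_le`). The diagonal of `A - P` contributes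
at most `n` to the squared error. The bound for the expectation is the integral of the tail bound.
-/

noncomputable section

/-! ### The Frobenius inner product -/

/-- The Frobenius inner product `∑ i j, X i j * Y i j` of two real matrices. -/
def frobInner {m n : Type*} [Fintype m] [Fintype n] (X Y : Matrix m n ℝ) : ℝ :=
  ∑ i, ∑ j, X i j * Y i j

section FrobInner

variable {m n : Type*} [Fintype m] [Fintype n]

lemma frobenius_norm_sq (M : Matrix m n ℝ) : ‖M‖ ^ 2 = ∑ i, ∑ j, M i j ^ 2 := by
  have h : (0 : ℝ) ≤ ∑ i, ∑ j, ‖M i j‖ ^ (2 : ℝ) :=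
    Finset.sum_nonneg fun i _ => Finset.sum_nonneg fun j _ => by positivity
  rw [Matrix.frobenius_norm_def, ← Real.sqrt_eq_rpow, Real.sq_sqrt h]
  simp

lemma frobInner_add_right (X Y Z : Matrix m n ℝ) :
    frobInner X (Y + Z) = frobInner X Y + frobInner X Z := by
  simp [frobInner, mul_add, Finset.sum_add_distrib]

lemma frobInner_add_left (X Y Z : Matrix m n ℝ) :
    frobInner (X + Y) Z = frobInner X Z + frobInner Y Z := by
  simp [frobInner, add_mul, Finset.sum_add_distrib]

lemma frobInner_smul_right (a : ℝ) (X Y : Matrix m n ℝ) :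
    frobInner X (a • Y) = a * frobInner X Y := by
  simp [frobInner, Finset.mul_sum, mul_left_comm]

lemma frobenius_norm_add_sq (X Y : Matrix m n ℝ) :
    ‖X + Y‖ ^ 2 = ‖X‖ ^ 2 + 2 * frobInner X Y + ‖Y‖ ^ 2 := by
  simp only [frobenius_norm_sq, frobInner, Finset.mul_sum, ← Finset.sum_add_distrib,
    Matrix.add_apply]
  refine Finset.sum_congr rfl fun i _ => Finset.sum_congr rfl fun j _ => by ring

lemma frobenius_norm_sub_sq (X Y : Matrix m n ℝ) :
    ‖X - Y‖ ^ 2 = ‖X‖ ^ 2 - 2 * frobInner X Y + ‖Y‖ ^ 2 := by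
  simp only [frobenius_norm_sq, frobInner, Finset.mul_sum, ← Finset.sum_add_distrib,
    ← Finset.sum_sub_distrib, Matrix.sub_apply]
  refine Finset.sum_congr rfl fun i _ => Finset.sum_congr rfl fun j _ => by ring

lemma frobInner_le_norm_mul_norm (X Y : Matrix m n ℝ) : frobInner X Y ≤ ‖X‖ * ‖Y‖ := by
  refine le_of_sq_le_sq ?_ (by positivity)
  simp only [mul_pow, frobenius_norm_sq, frobInner, ← Fintype.sum_prod_type']
  exact Finset.sum_mul_sq_le_sq_mul_sq _ _ _

end FrobInner

/-! ### Matrices of rank at most one -/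

section RankOne

variable {m n : Type*} [Fintype n]

lemma exists_eq_mul_of_rank_le_one {R : Matrix m n ℝ} (h : R.rank ≤ 1) :
    ∃ (u : m → ℝ) (v : n → ℝ), ∀ i j, R i j = u i * v j := by
  classical
  obtain ⟨w, hw⟩ := (finrank_le_one_iff (K := ℝ)
    (V := LinearMap.range R.mulVecLin)).1 h
  choose c hc using hw
  refine ⟨w.1, fun j => c ⟨R.mulVecLin (Pi.single j 1), LinearMap.mem_range_self _ _⟩,
    fun i j => ?_⟩
  have := congrFun (congrArg Subtype.val
    (hc ⟨R.mulVecLin (Pi.single j 1), LinearMap.mem_range_self _ _⟩)) i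
  rw [mul_comm]
  simpa using this.symm

lemma rank_le_one_of_eq_mul {R : Matrix m n ℝ} {u : m → ℝ} {v : n → ℝ}
    (h : ∀ i j, R i j = u i * v j) : R.rank ≤ 1 := by
  have : R = Matrix.vecMulVec u v := by ext i j; simp [h, Matrix.vecMulVec_apply]
  rw [this]
  exact Matrix.rank_vecMulVec_le u v

/-- The matrices of rank at most one are those with vanishing `2 × 2` minors; in particular they
form a closed set. -/
lemma rank_le_one_iff_minors {R : Matrix m n ℝ} :
    R.rank ≤ 1 ↔ ∀ i j k l, R i j * R k l = R i l * R k j := by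
  constructor
  · intro h i j k l
    obtain ⟨u, v, huv⟩ := exists_eq_mul_of_rank_le_one h
    simp only [huv]; ring
  · intro h
    by_cases h0 : ∀ i j, R i j = 0
    · exact rank_le_one_of_eq_mul (u := 0) (v := 0) (by simpa using h0)
    · push Not at h0
      obtain ⟨a, b, hab⟩ := h0
      refine rank_le_one_of_eq_mul (u := fun i => R i b) (v := fun j => R a j / R a b)
        fun i j => ?_
      have := h i j a b
      field_simp
      linarith

lemma exists_isRankOneProjection [Fintype m] (M : Matrix m n ℝ) : ∃ R, IsRankOneProjection M R := by
  -- the minimum is attained in the Euclidean space of all entries, which is proper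
  let s : Set (EuclideanSpace ℝ (m × n)) :=
    {x | ∀ i j k l, x (i, j) * x (k, l) = x (i, l) * x (k, j)}
  have hs : IsClosed s := by
    simp only [s, Set.ofPred_forall]
    refine isClosed_iInter fun i => isClosed_iInter fun j => isClosed_iInter fun k =>
      isClosed_iInter fun l => isClosed_eq (by fun_prop) (by fun_prop)
  let e : Matrix m n ℝ → EuclideanSpace ℝ (m × n) := fun R => WithLp.toLp 2 fun p => R p.1 p.2
  have he : ∀ R R' : Matrix m n ℝ, ‖R - R'‖ = dist (e R) (e R') := by
    intro R R'
    rw [EuclideanSpace.dist_eq, ← Real.sqrt_sq (norm_nonneg (R - R')), frobenius_norm_sq,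
      Fintype.sum_prod_type]
    simp [e, Real.dist_eq]
  obtain ⟨x, hx, hmin⟩ := hs.exists_infDist_eq_dist ⟨0, by simp [s]⟩ (e M)
  refine ⟨Matrix.of fun i j => x (i, j), rank_le_one_iff_minors.2 hx, fun R' hR' => ?_⟩
  rw [he, he]
  have : e (Matrix.of fun i j => x (i, j)) = x := rfl
  rw [this, ← hmin]
  exact Metric.infDist_le_dist_of_mem (rank_le_one_iff_minors.1 hR')

end RankOne

/-! ### Blockwise rank one matrices -/

section NestedRankOne

variable {ι κ : Type*}

/-- The matrix all of whose blocks `{i | r i = l} × {j | z j = k}` are of rank at most one: the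
block is the outer product of the vectors `(U i k)_{r i = l}` and `(V l j)_{z j = k}`. -/
def nestedRankOne (r z : ι → κ) (U : ι → κ → ℝ) (V : κ → ι → ℝ) : Matrix ι ι ℝ :=
  Matrix.of fun i j => U i (z j) * V (r i) j

lemma nestedRankOne_apply (r z : ι → κ) (U : ι → κ → ℝ) (V : κ → ι → ℝ) (i j : ι) :
    nestedRankOne r z U V i j = U i (z j) * V (r i) j := rfl

variable [Fintype ι] [Fintype κ] [DecidableEq κ]

lemma sum_mul_comp (r : ι → κ) (f : ι → ℝ) (g : κ → ℝ) :
    ∑ i, f i * g (r i) = ∑ l, (∑ i with r i = l, f i) * g l := by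
  rw [← Finset.sum_fiberwise (s := Finset.univ) (g := r)]
  refine Finset.sum_congr rfl fun l _ => ?_
  rw [Finset.sum_mul]
  refine Finset.sum_congr rfl fun i hi => ?_
  rw [(Finset.mem_filter.1 hi).2]

lemma nestedRankOne_norm_sq (r z : ι → κ) (U : ι → κ → ℝ) (V : κ → ι → ℝ) :
    ‖nestedRankOne r z U V‖ ^ 2 =
      ∑ l, ∑ j, (∑ i with r i = l, U i (z j) ^ 2) * V l j ^ 2 := by
  rw [frobenius_norm_sq, Finset.sum_comm, Finset.sum_comm (s := Finset.univ (α := κ))]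
  refine Finset.sum_congr rfl fun j _ => ?_
  rw [← sum_mul_comp r (fun i => U i (z j) ^ 2) (fun l => V l j ^ 2)]
  simp [nestedRankOne_apply, mul_pow]

/-- The difference of two blockwise rank one matrices is an orthogonal sum of two such matrices:
in each block, the second column factor is replaced by its component orthogonal to the first. -/
lemma exists_orthogonal_split (r z : ι → κ) (U U' : ι → κ → ℝ) (V V' : κ → ι → ℝ) :
    ∃ (X Y : ι → κ → ℝ) (W W' : κ → ι → ℝ),
      nestedRankOne r z U V - nestedRankOne r z U' V' =
        nestedRankOne r z X W + nestedRankOne r z Y W' ∧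
      ‖nestedRankOne r z U V - nestedRankOne r z U' V'‖ ^ 2 =
        ‖nestedRankOne r z X W‖ ^ 2 + ‖nestedRankOne r z Y W'‖ ^ 2 := by
  let a : κ → κ → ℝ := fun l k =>
    (∑ i with r i = l, U i k * U' i k) / (∑ i with r i = l, U i k ^ 2)
  let Y : ι → κ → ℝ := fun i k => a (r i) k * U i k - U' i k
  let W : κ → ι → ℝ := fun l j => V l j - a l (z j) * V' l j
  have hsum : nestedRankOne r z U V - nestedRankOne r z U' V' =
      nestedRankOne r z U W + nestedRankOne r z Y V' := by
    ext i j
    simp only [Matrix.sub_apply, Matrix.add_apply, nestedRankOne_apply, W, Y]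
    ring
  have horth : ∀ l k, ∑ i with r i = l, U i k * Y i k = 0 := by
    intro l k
    have h1 : ∑ i with r i = l, U i k * Y i k =
        a l k * (∑ i with r i = l, U i k ^ 2) - ∑ i with r i = l, U i k * U' i k := by
      rw [Finset.mul_sum, ← Finset.sum_sub_distrib]
      refine Finset.sum_congr rfl fun i hi => ?_
      simp only [Y, (Finset.mem_filter.1 hi).2]
      ring
    rw [h1]
    by_cases h0 : ∑ i with r i = l, U i k ^ 2 = 0
    · -- then `U` vanishes on the block
      have h2 := (Finset.sum_eq_zero_iff_of_nonneg fun i _ => sq_nonneg (U i k)).1 h0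
      rw [h0, mul_zero, zero_sub, neg_eq_zero]
      exact Finset.sum_eq_zero fun i hi => by
        rw [pow_eq_zero_iff two_ne_zero |>.1 (h2 i hi), zero_mul]
    · simp only [a]
      rw [div_mul_cancel₀ _ h0, sub_self]
  refine ⟨U, Y, W, V', hsum, ?_⟩
  rw [hsum, frobenius_norm_add_sq]
  have : frobInner (nestedRankOne r z U W) (nestedRankOne r z Y V') = 0 := by
    rw [frobInner, Finset.sum_comm]
    refine Finset.sum_eq_zero fun j _ => ?_
    have := sum_mul_comp r (fun i => U i (z j) * Y i (z j)) (fun l => W l j * V' l j)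
    simp only [horth, zero_mul, Finset.sum_const_zero] at this
    rw [← this]
    refine Finset.sum_congr rfl fun i _ => ?_
    simp only [nestedRankOne_apply]; ring
  rw [this]; ring

end NestedRankOne

/-! ### Fits of a matrix for a given clustering -/

namespace NestedClustering

variable {n : ℕ} (S : NestedClustering n)

/-- The meta-community of each node, with values in `Fin S.K` instead of `Fin S.L`. -/
def metaOf (i : Fin n) : Fin S.K := Fin.castLE S.L_le (S.c (S.z i))

/-- A matrix is blockwise of rank one with respect to `S` if all of its block columns are outer
products. -/
def IsBlockRankOne (M : Matrix (Fin n) (Fin n) ℝ) : Prop :=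
  ∃ U V, M = nestedRankOne S.metaOf S.z U V

lemma isBlockRankOne_iff {M : Matrix (Fin n) (Fin n) ℝ} :
    S.IsBlockRankOne M ↔ ∀ l k, (S.blockColumn M l k).rank ≤ 1 := by
  constructor
  · rintro ⟨U, V, rfl⟩ l k
    refine rank_le_one_of_eq_mul (u := fun i => U i.1 k)
      (v := fun j => V (Fin.castLE S.L_le l) j.1) fun i j => ?_
    simp [blockColumn, nestedRankOne_apply, metaOf, i.2, j.2]
  · intro h
    choose u v huv using fun l k => exists_eq_mul_of_rank_le_one (h l k)
    refine ⟨fun i k => u (S.c (S.z i)) k ⟨i, rfl⟩,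
      fun m j => if hm : m.1 < S.L then v ⟨m, hm⟩ (S.z j) ⟨j, rfl⟩ else 0, ?_⟩
    ext i j
    have := huv (S.c (S.z i)) (S.z j) ⟨i, rfl⟩ ⟨j, rfl⟩
    simpa [nestedRankOne_apply, metaOf, blockColumn] using this

lemma sum_norm_blockColumn_sq (M : Matrix (Fin n) (Fin n) ℝ) :
    ∑ l, ∑ k, ‖S.blockColumn M l k‖ ^ 2 = ‖M‖ ^ 2 := by
  simp only [frobenius_norm_sq, blockColumn, Matrix.submatrix_apply]
  have h1 : ∀ f : Fin n → ℝ, ∑ k, ∑ j : {j // S.z j = k}, f j = ∑ j, f j := fun f => by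
    rw [← (Equiv.sigmaFiberEquiv S.z).sum_comp, Fintype.sum_sigma]; rfl
  have h2 : ∀ f : Fin n → ℝ, ∑ l, ∑ i : {i // S.c (S.z i) = l}, f i = ∑ i, f i := fun f => by
    rw [← (Equiv.sigmaFiberEquiv fun i => S.c (S.z i)).sum_comp, Fintype.sum_sigma]; rfl
  rw [← h2]
  refine Finset.sum_congr rfl fun l _ => ?_
  rw [Finset.sum_comm]
  refine Finset.sum_congr rfl fun i _ => ?_
  rw [← h1]

lemma exists_isRankOneFit (M : Matrix (Fin n) (Fin n) ℝ) : ∃ T, IsRankOneFit M S T := by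
  choose R hR using fun l k => exists_isRankOneProjection (S.blockColumn M l k)
  refine ⟨Matrix.of fun i j => R (S.c (S.z i)) (S.z j) ⟨i, rfl⟩ ⟨j, rfl⟩, fun l k => ?_⟩
  convert hR l k using 1
  ext ⟨i, rfl⟩ ⟨j, rfl⟩
  rfl

end NestedClustering

lemma criterion_eq (Psi1 Psi2 Psi3 : ℝ) {n : ℕ} (A : Matrix (Fin n) (Fin n) ℝ)
    (S : NestedClustering n) (T : Matrix (Fin n) (Fin n) ℝ) :
    criterion Psi1 Psi2 Psi3 A S T = ‖A - T‖ ^ 2 + penalty Psi1 Psi2 Psi3 n S.K S.L := by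
  rw [criterion, ← S.sum_norm_blockColumn_sq]
  rfl

lemma IsRankOneFit.isBlockRankOne {n : ℕ} {A T : Matrix (Fin n) (Fin n) ℝ}
    {S : NestedClustering n} (h : IsRankOneFit A S T) : S.IsBlockRankOne T :=
  S.isBlockRankOne_iff.2 fun l k => (h l k).1

lemma IsRankOneFit.norm_sub_le {n : ℕ} {A T M : Matrix (Fin n) (Fin n) ℝ}
    {S : NestedClustering n} (h : IsRankOneFit A S T) (hM : S.IsBlockRankOne M) :
    ‖A - T‖ ≤ ‖A - M‖ := by
  refine le_of_sq_le_sq ?_ (norm_nonneg _)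
  rw [← S.sum_norm_blockColumn_sq, ← S.sum_norm_blockColumn_sq]
  refine Finset.sum_le_sum fun l _ => Finset.sum_le_sum fun k _ => ?_
  have := (h l k).2 _ (S.isBlockRankOne_iff.1 hM l k)
  exact pow_le_pow_left₀ (norm_nonneg _) this 2

lemma IsNestedBlockModel.isBlockRankOne {n : ℕ} {S : NestedClustering n}
    {P : Matrix (Fin n) (Fin n) ℝ} {H : Matrix (Fin n) (Fin S.L) ℝ}
    (h : IsNestedBlockModel S P H) : S.IsBlockRankOne P := by
  refine ⟨fun i k => S.blockMeans P (S.z i) k * H i (S.c k),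
    fun m j => if hm : m.1 < S.L then H j ⟨m, hm⟩ else 0, ?_⟩
  ext i j
  rw [h.blocks i j]
  simp [nestedRankOne_apply, NestedClustering.metaOf, mul_assoc]

/-- The basic inequality of penalized least squares, with the matrix of the model as competitor. -/
lemma IsPenalizedEstimator.norm_sub_sq_le {Psi1 Psi2 Psi3 : ℝ} {n : ℕ}
    {A P T : Matrix (Fin n) (Fin n) ℝ} {S S' : NestedClustering n}
    (h : IsPenalizedEstimator Psi1 Psi2 Psi3 A S T) (hP : S'.IsBlockRankOne P) :
    ‖T - P‖ ^ 2 + penalty Psi1 Psi2 Psi3 n S.K S.L ≤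
      2 * frobInner (A - P) (T - P) + penalty Psi1 Psi2 Psi3 n S'.K S'.L := by
  obtain ⟨T', hT'⟩ := S'.exists_isRankOneFit A
  have h1 := h.2 S' T' hT'
  rw [criterion_eq, criterion_eq] at h1
  have h2 : ‖A - T'‖ ^ 2 ≤ ‖A - P‖ ^ 2 :=
    pow_le_pow_left₀ (norm_nonneg _) (hT'.norm_sub_le hP) 2
  have h3 := frobenius_norm_sub_sq (A - P) (T - P)
  rw [sub_sub_sub_cancel_right] at h3
  linarith

/-! ### Integer vectors in a ball -/

/-- The integer vectors of squared Euclidean length at most `D`. -/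
def intBall (α : Type*) [Fintype α] [DecidableEq α] (D : ℕ) : Finset (α → ℤ) :=
  (Fintype.piFinset fun _ => Finset.Icc (-(D : ℤ)) D).filter fun m => ∑ a, m a ^ 2 ≤ (D : ℤ)

section IntBall

variable {α : Type*} [Fintype α] [DecidableEq α]

lemma mem_intBall {D : ℕ} {m : α → ℤ} : m ∈ intBall α D ↔ ∑ a, m a ^ 2 ≤ (D : ℤ) := by
  simp only [intBall, Finset.mem_filter, Fintype.mem_piFinset, Finset.mem_Icc,
    and_iff_right_iff_imp]
  intro h a
  have h1 : m a ^ 2 ≤ D :=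
    (Finset.single_le_sum (fun b _ => sq_nonneg (m b)) (Finset.mem_univ a)).trans h
  constructor <;> nlinarith

lemma sum_half_pow_natAbs (D : ℕ) :
    ∑ j ∈ Finset.Icc (-(D : ℤ)) D, (1 / 2 : ℝ) ^ j.natAbs = 3 - 2 * (1 / 2) ^ D := by
  induction D with
  | zero => norm_num
  | succ D ih =>
    have h : Finset.Icc (-((D + 1 : ℕ) : ℤ)) ((D + 1 : ℕ) : ℤ) =
        insert (-((D + 1 : ℕ) : ℤ)) (insert ((D + 1 : ℕ) : ℤ) (Finset.Icc (-(D : ℤ)) D)) := by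
      ext j
      simp only [Finset.mem_Icc, Finset.mem_insert]
      omega
    rw [h, Finset.sum_insert, Finset.sum_insert, ih, Int.natAbs_neg, Int.natAbs_natCast]
    · ring
    · simp
    · simp only [Finset.mem_insert, Finset.mem_Icc]
      omega

/-- Each vector of the ball has weight at least `2 ^ (-D)` under the product of the weights
`2 ^ (-|j|)`, whose total mass is at most `3` per coordinate. -/
lemma card_intBall_le (D : ℕ) :
    ((intBall α D).card : ℝ) ≤ 3 ^ Fintype.card α * 2 ^ D := by
  have h1 : ∀ m ∈ intBall α D, (1 : ℝ) ≤ 2 ^ D * ∏ a, (1 / 2 : ℝ) ^ (m a).natAbs := by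
    intro m hm
    have h : ∑ a, (m a).natAbs ≤ D := by
      have h2 : ((∑ a, (m a).natAbs : ℕ) : ℤ) ≤ D := by
        refine le_trans ?_ (mem_intBall.1 hm)
        rw [Nat.cast_sum]
        refine Finset.sum_le_sum fun a _ => ?_
        rw [Int.natCast_natAbs, ← sq_abs]
        exact Int.le_self_sq _
      exact_mod_cast h2
    rw [Finset.prod_pow_eq_pow_sum, one_div, inv_pow, ← div_eq_mul_inv, le_div_iff₀ (by positivity),
      one_mul]
    exact pow_le_pow_right₀ one_le_two h
  calc ((intBall α D).card : ℝ) = ∑ m ∈ intBall α D, (1 : ℝ) := by simp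
    _ ≤ ∑ m ∈ intBall α D, 2 ^ D * ∏ a, (1 / 2 : ℝ) ^ (m a).natAbs := Finset.sum_le_sum h1
    _ ≤ ∑ m ∈ Fintype.piFinset fun _ : α => Finset.Icc (-(D : ℤ)) D,
          2 ^ D * ∏ a, (1 / 2 : ℝ) ^ (m a).natAbs :=
        Finset.sum_le_sum_of_subset_of_nonneg (Finset.filter_subset _ _)
          fun m _ _ => by positivity
    _ = 2 ^ D * ∏ _a : α, ∑ j ∈ Finset.Icc (-(D : ℤ)) D, (1 / 2 : ℝ) ^ j.natAbs := by
        rw [← Finset.mul_sum, Finset.prod_univ_sum]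
    _ ≤ 2 ^ D * ∏ _a : α, 3 := by
        gcongr with a
        rw [sum_half_pow_natAbs]
        have : (0 : ℝ) < (1 / 2) ^ D := by positivity
        linarith
    _ = 3 ^ Fintype.card α * 2 ^ D := by simp [mul_comm]

/-- Rounding a real number towards zero to a multiple of `d`. -/
lemma exists_int_mul_near (x : ℝ) {d : ℝ} (hd : 0 < d) :
    ∃ m : ℤ, (m * d) ^ 2 ≤ x ^ 2 ∧ (x - m * d) ^ 2 ≤ d ^ 2 := by
  have key : ∀ y : ℝ, 0 ≤ y → ∃ m : ℤ, (m * d) ^ 2 ≤ y ^ 2 ∧ (y - m * d) ^ 2 ≤ d ^ 2 := by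
    intro y hy
    have h1 : (⌊y / d⌋ : ℝ) * d ≤ y := (le_div_iff₀ hd).1 (Int.floor_le _)
    have h2 : y < (⌊y / d⌋ + 1 : ℝ) * d := (div_lt_iff₀ hd).1 (Int.lt_floor_add_one _)
    have h3 : (0 : ℝ) ≤ ⌊y / d⌋ := by exact_mod_cast Int.floor_nonneg.2 (by positivity)
    refine ⟨⌊y / d⌋, pow_le_pow_left₀ (by positivity) h1 2,
      pow_le_pow_left₀ (by linarith) (by linarith) 2⟩
  rcases le_total 0 x with hx | hx
  · exact key x hx
  · obtain ⟨m, h1, h2⟩ := key (-x) (by linarith)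
    refine ⟨-m, ?_, ?_⟩
    · push_cast; linarith
    · push_cast; linarith

end IntBall

/-! ### A net of blockwise rank one matrices -/

section Net

variable {ι κ : Type*} [Fintype ι] [Fintype κ] [DecidableEq κ]

/-- The left factor of a net matrix: row `i` is a multiple of an integer vector, the mesh being
`1 / 4` divided by the square root of the size of the block of rows of `i`. -/
def gridLeft (r : ι → κ) (m : ι × κ → ℤ) (i : ι) (k : κ) : ℝ :=
  m (i, k) * (1 / 4 / √({i' | r i' = r i} : Finset ι).card)

/-- The right factor of a net matrix, an integer vector times `1 / 4` divided by the square root of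
the dimension. -/
def gridRight (m : κ × ι → ℤ) (l : κ) (j : ι) : ℝ :=
  m (l, j) * (1 / 4 / √(Fintype.card κ * Fintype.card ι : ℝ))


lemma exists_gridLeft_near [DecidableEq ι] (r : ι → κ) {U : ι → κ → ℝ}
    (hU : ∀ l k, ∑ i with r i = l, U i k ^ 2 ≤ 1) :
    ∃ m ∈ intBall (ι × κ) (16 * (Fintype.card κ * Fintype.card ι)),
      (∀ l k, ∑ i with r i = l, gridLeft r m i k ^ 2 ≤ 1) ∧
      ∀ l k, ∑ i with r i = l, (4 * (U i k - gridLeft r m i k)) ^ 2 ≤ 1 := by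
  set c : κ → ℝ := fun l => (({i' | r i' = l} : Finset ι).card : ℝ) with hc
  have hc0 : ∀ i, 0 < c (r i) := fun i => by
    simp only [hc, Nat.cast_pos, Finset.card_pos]
    exact ⟨i, by simp⟩
  have hd : ∀ i, (1 / 4 / √(c (r i))) ^ 2 = 1 / (16 * c (r i)) := fun i => by
    rw [div_pow, Real.sq_sqrt (hc0 i).le, div_pow, div_div]; norm_num
  choose m hm1 hm2 using fun (p : ι × κ) => exists_int_mul_near (U p.1 p.2)
    (d := 1 / 4 / √(c (r p.1))) (div_pos (by norm_num) (Real.sqrt_pos.2 (hc0 p.1)))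
  have hg : ∀ l k, ∑ i with r i = l, gridLeft r m i k ^ 2 ≤ 1 := fun l k =>
    (Finset.sum_le_sum fun i _ => hm1 (i, k)).trans (hU l k)
  refine ⟨m, ?_, hg, fun l k => ?_⟩
  · rw [mem_intBall]
    have h1 : ∀ i k, ((m (i, k) : ℝ)) ^ 2 = 16 * (gridLeft r m i k ^ 2 * c (r i)) := fun i k => by
      rw [gridLeft, mul_pow]
      change _ = 16 * (_ * (1 / 4 / √(c (r i))) ^ 2 * c (r i))
      rw [hd]
      have := (hc0 i).ne'
      field_simp
    have h2 : ∑ l, c l = Fintype.card ι := by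
      have := sum_mul_comp r (fun _ => (1 : ℝ)) (fun _ => 1)
      simpa [hc] using this.symm
    have h3 : (∑ p, (m p : ℝ) ^ 2) ≤ 16 * (Fintype.card κ * Fintype.card ι) := by
      rw [Fintype.sum_prod_type_right]
      simp only [h1, ← Finset.mul_sum]
      gcongr
      rw [← h2, ← nsmul_eq_mul, ← Finset.card_univ, ← Finset.sum_const]
      refine Finset.sum_le_sum fun k _ => ?_
      rw [sum_mul_comp r (fun i => gridLeft r m i k ^ 2) c]
      refine Finset.sum_le_sum fun l _ => ?_
      exact mul_le_of_le_one_left (by simp [hc]) (hg l k)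
    exact_mod_cast h3
  · have h1 : ∀ i ∈ ({i | r i = l} : Finset ι), (4 * (U i k - gridLeft r m i k)) ^ 2 ≤ 1 / c l := by
      intro i hi
      obtain rfl := (Finset.mem_filter.1 hi).2
      have := hm2 (i, k)
      rw [hd] at this
      have h5 := (hc0 i).ne'
      calc (4 * (U i k - gridLeft r m i k)) ^ 2 = 16 * (U i k - gridLeft r m i k) ^ 2 := by ring
        _ ≤ 16 * (1 / (16 * c (r i))) := by gcongr; exact this
        _ = 1 / c (r i) := by field_simp
    refine (Finset.sum_le_sum h1).trans ?_
    rw [Finset.sum_const, nsmul_eq_mul]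
    rw [mul_one_div]
    exact div_self_le_one _

lemma exists_gridRight_near [DecidableEq ι] [Nonempty ι] [Nonempty κ] {V : κ → ι → ℝ}
    (hV : ∑ l, ∑ j, V l j ^ 2 ≤ 1) :
    ∃ m ∈ intBall (κ × ι) (16 * (Fintype.card κ * Fintype.card ι)),
      ∑ l, ∑ j, gridRight m l j ^ 2 ≤ 1 ∧
      ∑ l, ∑ j, (4 * (V l j - gridRight m l j)) ^ 2 ≤ 1 := by
  set N : ℝ := Fintype.card κ * Fintype.card ι with hN
  have hN0 : 0 < N := by positivity
  have hd : (1 / 4 / √N) ^ 2 = 1 / (16 * N) := by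
    rw [div_pow, Real.sq_sqrt hN0.le, div_pow, div_div]; norm_num
  choose m hm1 hm2 using fun (p : κ × ι) => exists_int_mul_near (V p.1 p.2)
    (d := 1 / 4 / √N) (by positivity)
  have hg : ∑ l, ∑ j, gridRight m l j ^ 2 ≤ 1 :=
    (Finset.sum_le_sum fun l _ => Finset.sum_le_sum fun j _ => hm1 (l, j)).trans hV
  refine ⟨m, ?_, hg, ?_⟩
  · rw [mem_intBall]
    have h1 : ∀ l j, ((m (l, j) : ℝ)) ^ 2 = 16 * N * gridRight m l j ^ 2 := fun l j => by
      rw [gridRight, mul_pow, ← hN, hd]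
      field_simp
    have h3 : (∑ p, (m p : ℝ) ^ 2) ≤ 16 * (Fintype.card κ * Fintype.card ι) := by
      rw [Fintype.sum_prod_type, ← hN]
      simp only [h1, ← Finset.mul_sum]
      exact mul_le_of_le_one_right (by positivity) hg
    exact_mod_cast h3
  · have h1 : ∀ l j, (4 * (V l j - gridRight m l j)) ^ 2 ≤ 1 / N := by
      intro l j
      have := hm2 (l, j)
      rw [hd] at this
      calc (4 * (V l j - gridRight m l j)) ^ 2 = 16 * (V l j - gridRight m l j) ^ 2 := by ring
        _ ≤ 16 * (1 / (16 * N)) := by gcongr; exact this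
        _ = 1 / N := by field_simp
    refine (Finset.sum_le_sum fun l _ => Finset.sum_le_sum fun j _ => h1 l j).trans ?_
    simp only [Finset.sum_const, nsmul_eq_mul, Finset.card_univ, ← mul_assoc]
    rw [← hN]
    rw [mul_one_div]
    exact div_self_le_one _

lemma norm_nestedRankOne_le_one (r z : ι → κ) {U : ι → κ → ℝ} {V : κ → ι → ℝ}
    (hU : ∀ l k, ∑ i with r i = l, U i k ^ 2 ≤ 1) (hV : ∑ l, ∑ j, V l j ^ 2 ≤ 1) :
    ‖nestedRankOne r z U V‖ ≤ 1 := by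
  have : ‖nestedRankOne r z U V‖ ^ 2 ≤ 1 ^ 2 := by
    rw [nestedRankOne_norm_sq, one_pow]
    refine le_trans (Finset.sum_le_sum fun l _ => Finset.sum_le_sum fun j _ => ?_) hV
    exact mul_le_of_le_one_left (sq_nonneg _) (hU l _)
  exact le_of_sq_le_sq this zero_le_one

/-- Every blockwise rank one matrix has factors that are normalized: the left factors of the blocks
are at most unit vectors, and the right factors carry the norm of the matrix. -/
lemma exists_normalized_factors (r z : ι → κ) (U : ι → κ → ℝ) (V : κ → ι → ℝ) :
    ∃ U' V', nestedRankOne r z U V = nestedRankOne r z U' V' ∧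
      (∀ l k, ∑ i with r i = l, U' i k ^ 2 ≤ 1) ∧
      ∑ l, ∑ j, V' l j ^ 2 = ‖nestedRankOne r z U V‖ ^ 2 := by
  let a : κ → κ → ℝ := fun l k => ∑ i with r i = l, U i k ^ 2
  have ha : ∀ l k, 0 ≤ a l k := fun l k => Finset.sum_nonneg fun i _ => sq_nonneg _
  refine ⟨fun i k => U i k / √(a (r i) k), fun l j => √(a l (z j)) * V l j, ?_, fun l k => ?_, ?_⟩
  · ext i j
    simp only [nestedRankOne_apply]
    by_cases h0 : a (r i) (z j) = 0
    · have := (Finset.sum_eq_zero_iff_of_nonneg fun i _ => sq_nonneg (U i (z j))).1 h0 i (by simp)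
      rw [pow_eq_zero_iff two_ne_zero |>.1 this]
      simp
    · have : √(a (r i) (z j)) ≠ 0 := by
        rw [Real.sqrt_ne_zero (ha _ _)]; exact h0
      field_simp
  · have : ∀ i ∈ ({i | r i = l} : Finset ι), (U i k / √(a (r i) k)) ^ 2 = U i k ^ 2 / a l k := by
      intro i hi
      rw [(Finset.mem_filter.1 hi).2, div_pow, Real.sq_sqrt (ha _ _)]
    rw [Finset.sum_congr rfl this, ← Finset.sum_div]
    exact div_self_le_one _
  · rw [nestedRankOne_norm_sq]
    refine Finset.sum_congr rfl fun l _ => Finset.sum_congr rfl fun j _ => ?_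
    rw [mul_pow, Real.sq_sqrt (ha _ _)]

/-- If `⟨X, ·⟩ ≤ s` holds on the matrices of the net, up to normalization, then `⟨X, M⟩ ≤ 2 s ‖M‖`
for all blockwise rank one matrices `M`. The rounding error is the sum of two blockwise rank one
matrices that are smaller by the factor `1 / 4`, so the supremum `β` over the normalized matrices
satisfies `β ≤ s + β / 4 + β / 4`. -/
lemma frobInner_nestedRankOne_le [DecidableEq ι] [Nonempty ι] [Nonempty κ] (r z : ι → κ)
    (X : Matrix ι ι ℝ) {s : ℝ} (hs : 0 ≤ s)
    (h : ∀ m ∈ intBall (ι × κ) (16 * (Fintype.card κ * Fintype.card ι)),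
      ∀ m' ∈ intBall (κ × ι) (16 * (Fintype.card κ * Fintype.card ι)),
      frobInner X (nestedRankOne r z (gridLeft r m) (gridRight m')) ≤
        s * ‖nestedRankOne r z (gridLeft r m) (gridRight m')‖)
    (U : ι → κ → ℝ) (V : κ → ι → ℝ) :
    frobInner X (nestedRankOne r z U V) ≤ 2 * s * ‖nestedRankOne r z U V‖ := by
  let T : Set ℝ := {b | ∃ U V, (∀ l k, ∑ i with r i = l, U i k ^ 2 ≤ 1) ∧
    ∑ l, ∑ j, V l j ^ 2 ≤ 1 ∧ b = frobInner X (nestedRankOne r z U V)}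
  have hT : BddAbove T := by
    refine ⟨‖X‖, ?_⟩
    rintro b ⟨U, V, hU, hV, rfl⟩
    exact (frobInner_le_norm_mul_norm _ _).trans
      (mul_le_of_le_one_right (norm_nonneg _) (norm_nestedRankOne_le_one r z hU hV))
  have hle : ∀ b ∈ T, b ≤ s + 1 / 4 * sSup T + 1 / 4 * sSup T := by
    rintro b ⟨U, V, hU, hV, rfl⟩
    obtain ⟨m, hm, hm1, hm2⟩ := exists_gridLeft_near r hU
    obtain ⟨m', hm', hm1', hm2'⟩ := exists_gridRight_near hV
    have hsum : nestedRankOne r z U V = nestedRankOne r z (gridLeft r m) (gridRight m') +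
        (1 / 4 : ℝ) • nestedRankOne r z (fun i k => 4 * (U i k - gridLeft r m i k)) V +
        (1 / 4 : ℝ) • nestedRankOne r z (gridLeft r m)
          (fun l j => 4 * (V l j - gridRight m' l j)) := by
      ext i j
      simp only [Matrix.add_apply, Matrix.smul_apply, nestedRankOne_apply, smul_eq_mul]
      ring
    rw [hsum, frobInner_add_right, frobInner_add_right, frobInner_smul_right,
      frobInner_smul_right]
    gcongr
    · exact (h m hm m' hm').trans
        (mul_le_of_le_one_right hs (norm_nestedRankOne_le_one r z hm1 hm1'))
    · exact le_csSup hT ⟨_, _, hm2, hV, rfl⟩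
    · exact le_csSup hT ⟨_, _, hm1, hm2', rfl⟩
  have hne : T.Nonempty := ⟨_, 0, 0, by simp, by simp, rfl⟩
  have hsup : sSup T ≤ 2 * s := by
    have := csSup_le hne hle
    linarith
  obtain ⟨U', V', hUV, hU', hV'⟩ := exists_normalized_factors r z U V
  by_cases h0 : ‖nestedRankOne r z U V‖ = 0
  · have := frobInner_le_norm_mul_norm X (nestedRankOne r z U V)
    rw [h0, mul_zero] at this ⊢
    exact this
  · set N := ‖nestedRankOne r z U V‖ with hN
    have h1 : frobInner X (nestedRankOne r z U' (fun l j => N⁻¹ * V' l j)) ≤ 2 * s := by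
      refine (le_csSup hT ⟨_, _, hU', ?_, rfl⟩).trans hsup
      simp only [mul_pow, ← Finset.mul_sum]
      rw [hV', ← mul_pow, inv_mul_cancel₀ h0, one_pow]
    have h2 : nestedRankOne r z U V = N • nestedRankOne r z U' (fun l j => N⁻¹ * V' l j) := by
      rw [hUV]
      ext i j
      simp only [Matrix.smul_apply, nestedRankOne_apply, smul_eq_mul]
      field_simp
    rw [h2, frobInner_smul_right, mul_comm]
    gcongr

end Net

/-! ### Concentration of linear forms of the noise -/

/-- The off-diagonal part of `A - P`. The diagonal of `A` is not modelled, so it is left out. -/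
def noise {n : ℕ} (A P : Matrix (Fin n) (Fin n) ℝ) : Matrix (Fin n) (Fin n) ℝ :=
  Matrix.of fun i j => if i = j then 0 else A i j - P i j

lemma sum_eq_sum_diag_add_sum_lt {n : ℕ} (f : Fin n → Fin n → ℝ) :
    ∑ i, ∑ j, f i j = ∑ i, f i i +
      ∑ e : {e : Fin n × Fin n // e.1 < e.2}, (f e.1.1 e.1.2 + f e.1.2 e.1.1) := by
  have h1 : ∀ g : Fin n × Fin n → ℝ, ∑ e : {e : Fin n × Fin n // e.1 < e.2}, g e.1 =
      ∑ p, if p.1 < p.2 then g p else 0 := fun g => by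
    rw [← Finset.sum_filter]
    exact (Finset.sum_subtype _ (by simp) g).symm
  have h2 : ∑ i, f i i = ∑ p : Fin n × Fin n, if p.1 = p.2 then f p.1 p.2 else 0 := by
    rw [Fintype.sum_prod_type]
    simp
  have h3 : ∑ p : Fin n × Fin n, (if p.1 < p.2 then f p.2 p.1 else 0) =
      ∑ p : Fin n × Fin n, if p.2 < p.1 then f p.1 p.2 else 0 := by
    rw [← (Equiv.prodComm (Fin n) (Fin n)).sum_comp]
    rfl
  rw [Finset.sum_add_distrib, h1 (fun p => f p.1 p.2), h1 (fun p => f p.2 p.1), h2, h3,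
    ← Finset.sum_add_distrib, ← Finset.sum_add_distrib, ← Fintype.sum_prod_type']
  refine Finset.sum_congr rfl fun p _ => ?_
  rcases lt_trichotomy p.1 p.2 with h | h | h
  · simp [h, h.ne, h.not_gt]
  · simp [h]
  · simp [h, h.ne', h.not_gt]

section Concentration

variable {n : ℕ} {Ω : Type*} [MeasurableSpace Ω] {μ : Measure Ω}
  {A : Ω → Matrix (Fin n) (Fin n) ℝ} {P : Matrix (Fin n) (Fin n) ℝ}

lemma IsRandomAdjacency.integral_apply (hA : IsRandomAdjacency μ A P) {i j : Fin n} (hij : i < j)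
    (hP : 0 ≤ P i j) : ∫ ω, A ω i j ∂μ = P i j := by
  have h1 : (fun ω => A ω i j) = Set.indicator {ω | A ω i j = 1} 1 := by
    ext ω
    rcases hA.zero_or_one ω i j with h | h <;> simp [h]
  have h2 : MeasurableSet {ω | A ω i j = 1} := hA.measurable i j (measurableSet_singleton 1)
  rw [h1, integral_indicator_one h2, measureReal_def,
    hA.bernoulli i j hij, ENNReal.toReal_ofReal hP]

lemma IsRandomAdjacency.measureReal_lt_frobInner_noise_le [IsProbabilityMeasure μ]
    (hA : IsRandomAdjacency μ A P) (hP : P.IsSymm) (hP0 : ∀ i j, 0 ≤ P i j)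
    (X : Matrix (Fin n) (Fin n) ℝ) {s : ℝ} (hs : 0 ≤ s) :
    μ.real {ω | s * ‖X‖ < frobInner (noise (A ω) P) X} ≤ Real.exp (-s ^ 2 / 2) := by
  by_cases hX : ‖X‖ = 0
  · have : {ω | s * ‖X‖ < frobInner (noise (A ω) P) X} = ∅ := by
      refine Set.eq_empty_of_forall_notMem fun ω hω => ?_
      have h1 := frobInner_le_norm_mul_norm (noise (A ω) P) X
      simp only [Set.mem_ofPred_eq, hX, mul_zero] at h1 hω
      linarith
    rw [this, measureReal_empty]
    positivity
  let c : {e : Fin n × Fin n // e.1 < e.2} → ℝ := fun e => X e.1.1 e.1.2 + X e.1.2 e.1.1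
  let Y : {e : Fin n × Fin n // e.1 < e.2} → Ω → ℝ :=
    fun e ω => c e * (A ω e.1.1 e.1.2 - P e.1.1 e.1.2)
  have hY : ∀ ω, frobInner (noise (A ω) P) X = ∑ e, Y e ω := by
    intro ω
    rw [frobInner, sum_eq_sum_diag_add_sum_lt]
    simp only [noise, Matrix.of_apply, if_true, zero_mul, Finset.sum_const_zero, zero_add]
    refine Finset.sum_congr rfl fun e _ => ?_
    rw [if_neg e.2.ne, if_neg e.2.ne', (hA.symm ω).apply e.1.1 e.1.2,
      hP.apply e.1.1 e.1.2]
    simp only [Y, c]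
    ring
  have hindep : iIndepFun Y μ :=
    hA.indep.comp (fun e x => c e * (x - P e.1.1 e.1.2)) fun e => by fun_prop
  let v : {e : Fin n × Fin n // e.1 < e.2} → NNReal :=
    fun e => NNReal.mk (c e ^ 2) (sq_nonneg _) * (‖(1 : ℝ) - 0‖₊ / 2) ^ 2
  have hv : ∀ e, (v e : ℝ) = c e ^ 2 * (1 / 2) ^ 2 := fun e => by simp [v]
  have hsub : ∀ e, HasSubgaussianMGF (Y e) (v e) μ := by
    intro e
    have h1 := hasSubgaussianMGF_of_mem_Icc (μ := μ) (X := fun ω => A ω e.1.1 e.1.2) (a := 0)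
      (b := 1) (hA.measurable _ _).aemeasurable (ae_of_all _ fun ω => by
        rcases hA.zero_or_one ω e.1.1 e.1.2 with h | h <;> simp [h])
    rw [hA.integral_apply e.2 (hP0 _ _)] at h1
    exact h1.const_mul (c e)
  have hsum := HasSubgaussianMGF.sum_of_iIndepFun hindep (s := Finset.univ) fun e _ => hsub e
  have hvar : ∑ e, c e ^ 2 * (1 / 2 : ℝ) ^ 2 ≤ ‖X‖ ^ 2 := by
    rw [frobenius_norm_sq, sum_eq_sum_diag_add_sum_lt]
    refine le_trans (Finset.sum_le_sum fun e _ => ?_)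
      (le_add_of_nonneg_left (Finset.sum_nonneg fun i _ => sq_nonneg _))
    simp only [c]
    nlinarith [sq_nonneg (X e.1.1 e.1.2 - X e.1.2 e.1.1), sq_nonneg (X e.1.1 e.1.2),
      sq_nonneg (X e.1.2 e.1.1)]
  have hsum' : HasSubgaussianMGF (fun ω => ∑ e, Y e ω) (‖X‖₊ ^ 2) μ := by
    refine ⟨hsum.integrable_exp_mul, fun t => (hsum.mgf_le t).trans (Real.exp_le_exp.2 ?_)⟩
    gcongr
    rw [← NNReal.coe_le_coe, NNReal.coe_pow, coe_nnnorm]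
    refine le_trans (le_of_eq ?_) hvar
    rw [NNReal.coe_sum]
    exact Finset.sum_congr rfl fun e _ => hv e
  have hfin := hsum'.measure_ge_le (ε := s * ‖X‖) (by positivity)
  refine (measureReal_mono (fun ω hω => ?_)).trans (hfin.trans (le_of_eq ?_))
  · rw [Set.mem_ofPred_eq, hY] at hω
    exact hω.le
  · congr 1
    simp only [NNReal.coe_pow, coe_nnnorm]
    field_simp

end Concentration

/-! ### The union bound over all clusterings -/

/-- The clusterings of the nodes into `K` communities and at most `K` meta-communities, for all `K`,
encoded by the pair of the meta-communities and the communities of the nodes. -/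
abbrev ClusteringCode (n : ℕ) : Type :=
  Σ K : Finset.Icc 1 n, (Fin n → Fin K.1) × (Fin n → Fin K.1)

/-- The noise level `√(2 (29 n K + t))` that is exceeded with small probability by the linear forms
belonging to clusterings into `K` communities. -/
def noiseLevel (n K : ℕ) (t : ℝ) : ℝ := √(2 * (29 * n * K + t))

/-- The matrices whose linear forms have to be controlled for the communities `z` and the
meta-communities `r`: those of the net and one more matrix `Q`. -/
def testMatrices {n K : ℕ} (r z : Fin n → Fin K) (Q : Matrix (Fin n) (Fin n) ℝ) :
    Finset (Matrix (Fin n) (Fin n) ℝ) :=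
  open Classical in
  insert Q ((intBall (Fin n × Fin K) (16 * (K * n)) ×ˢ intBall (Fin K × Fin n) (16 * (K * n))).image
    fun m => nestedRankOne r z (gridLeft r m.1) (gridRight m.2))

lemma card_testMatrices_le {n K : ℕ} (hn : 1 ≤ n) (hK : 1 ≤ K) (r z : Fin n → Fin K)
    (Q : Matrix (Fin n) (Fin n) ℝ) :
    ((testMatrices r z Q).card : ℝ) ≤ Real.exp (26 * n * K) := by
  classical
  set N := n * K with hN
  have hN1 : 1 ≤ N := Nat.one_le_iff_ne_zero.2 (by positivity)
  have h1 := card_intBall_le (α := Fin n × Fin K) (16 * (K * n))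
  have h2 := card_intBall_le (α := Fin K × Fin n) (16 * (K * n))
  simp only [Fintype.card_prod, Fintype.card_fin] at h1 h2
  rw [mul_comm K n, ← hN] at h1 h2
  have h3 : ((testMatrices r z Q).card : ℝ) ≤
      (intBall (Fin n × Fin K) (16 * (K * n))).card *
        (intBall (Fin K × Fin n) (16 * (K * n))).card + 1 := by
    rw [testMatrices]
    have := (Finset.card_insert_le Q ((intBall (Fin n × Fin K) (16 * (K * n)) ×ˢ
      intBall (Fin K × Fin n) (16 * (K * n))).image
        fun m => nestedRankOne r z (gridLeft r m.1) (gridRight m.2))).trans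
      (Nat.add_le_add_right Finset.card_image_le 1)
    rw [Finset.card_product] at this
    exact_mod_cast this
  rw [mul_comm K n, ← hN] at h3
  have h4 : (3 ^ N * 2 ^ (16 * N) : ℝ) * (3 ^ N * 2 ^ (16 * N)) ≤ Real.exp (25 * N) := by
    have h5 : (9 * 2 ^ 32 : ℝ) ≤ Real.exp 25 := by
      have h6 := Real.exp_one_gt_d9
      calc (9 * 2 ^ 32 : ℝ) ≤ 2.7182818283 ^ 25 := by norm_num
        _ ≤ Real.exp 1 ^ 25 := by gcongr
        _ = Real.exp 25 := by rw [← Real.exp_nat_mul]; norm_num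
    calc (3 ^ N * 2 ^ (16 * N) : ℝ) * (3 ^ N * 2 ^ (16 * N)) = (9 * 2 ^ 32) ^ N := by
          rw [pow_mul (2 : ℝ) 16 N, ← mul_pow, ← mul_pow]; norm_num
      _ ≤ Real.exp 25 ^ N := by gcongr
      _ = Real.exp (25 * N) := by rw [← Real.exp_nat_mul, mul_comm]
  have h7 : (2 : ℝ) ≤ Real.exp N := by
    have h8 := Real.add_one_le_exp (N : ℝ)
    have : (1 : ℝ) ≤ N := by exact_mod_cast hN1
    linarith
  have h9 : (1 : ℝ) ≤ Real.exp (25 * N) := Real.one_le_exp (by positivity)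
  calc ((testMatrices r z Q).card : ℝ)
      ≤ (3 ^ N * 2 ^ (16 * N)) * (3 ^ N * 2 ^ (16 * N)) + 1 := by
        refine h3.trans ?_; gcongr
    _ ≤ Real.exp (25 * N) + Real.exp (25 * N) := add_le_add h4 h9
    _ ≤ Real.exp N * Real.exp (25 * N) := by nlinarith
    _ = Real.exp (26 * n * K) := by rw [← Real.exp_add, hN]; push_cast; ring_nf

section UnionBound

variable {n : ℕ} {Ω : Type*} [MeasurableSpace Ω] {μ : Measure Ω} [IsProbabilityMeasure μ]
  {A : Ω → Matrix (Fin n) (Fin n) ℝ} {P : Matrix (Fin n) (Fin n) ℝ}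

/-- With high probability, the linear forms of the noise in all test matrices of all clusterings are
below the noise level. The `K ^ (2 n) ≤ exp (2 n K)` clusterings into `K` communities have
`exp (26 n K)` test matrices each, so their contribution is at most `exp (-n K - t)`. -/
lemma IsRandomAdjacency.measureReal_exists_lt_frobInner_noise_le (hA : IsRandomAdjacency μ A P)
    (hP : P.IsSymm) (hP0 : ∀ i j, 0 ≤ P i j)
    (Q : ClusteringCode n → Matrix (Fin n) (Fin n) ℝ) {t : ℝ} (ht : 0 ≤ t) :
    μ.real {ω | ∃ p : ClusteringCode n, ∃ X ∈ testMatrices p.2.1 p.2.2 (Q p),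
      noiseLevel n p.1 t * ‖X‖ < frobInner (noise (A ω) P) X} ≤ Real.exp (-t) := by
  have h1 : ∀ p : ClusteringCode n,
      μ.real (⋃ X ∈ testMatrices p.2.1 p.2.2 (Q p),
        {ω | noiseLevel n p.1 t * ‖X‖ < frobInner (noise (A ω) P) X}) ≤
      Real.exp (-(3 * n * (p.1 : ℕ))) * Real.exp (-t) := by
    intro p
    obtain ⟨hK, hKn⟩ := Finset.mem_Icc.1 p.1.2
    have hn : 1 ≤ n := hK.trans hKn
    calc _ ≤ ∑ X ∈ testMatrices p.2.1 p.2.2 (Q p),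
          μ.real {ω | noiseLevel n p.1 t * ‖X‖ < frobInner (noise (A ω) P) X} :=
          measureReal_biUnion_finset_le _ _
      _ ≤ ∑ X ∈ testMatrices p.2.1 p.2.2 (Q p),
          Real.exp (-(noiseLevel n p.1 t) ^ 2 / 2) :=
          Finset.sum_le_sum fun X _ =>
            hA.measureReal_lt_frobInner_noise_le hP hP0 X (Real.sqrt_nonneg _)
      _ ≤ Real.exp (26 * n * (p.1 : ℕ)) * Real.exp (-(29 * n * (p.1 : ℕ) + t)) := by
          rw [Finset.sum_const, nsmul_eq_mul, noiseLevel, Real.sq_sqrt (by positivity)]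
          refine mul_le_mul (card_testMatrices_le hn hK _ _ _) (le_of_eq ?_)
            (by positivity) (by positivity)
          congr 1; ring
      _ = _ := by rw [← Real.exp_add, ← Real.exp_add]; congr 1; ring
  have h2 : ∀ K : Finset.Icc 1 n, ∑ _q : (Fin n → Fin K.1) × (Fin n → Fin K.1),
      Real.exp (-(3 * n * (K : ℕ))) ≤ Real.exp (-n) := by
    intro K
    have h3 : ((K : ℕ) : ℝ) ≤ Real.exp (K : ℕ) := by
      have := Real.add_one_le_exp ((K : ℕ) : ℝ)
      linarith
    have h4 : (((K : ℕ) : ℝ) ^ n) ≤ Real.exp (n * (K : ℕ)) := by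
      rw [Real.exp_nat_mul]; gcongr
    rw [Finset.sum_const, nsmul_eq_mul, Finset.card_univ]
    simp only [Fintype.card_prod, Fintype.card_fun, Fintype.card_fin]
    rw [Nat.cast_mul, Nat.cast_pow]
    calc _ ≤ Real.exp (n * (K : ℕ)) * Real.exp (n * (K : ℕ)) *
          Real.exp (-(3 * n * (K : ℕ))) := by gcongr
      _ = Real.exp (-(n * (K : ℕ))) := by
          rw [← Real.exp_add, ← Real.exp_add]; congr 1; ring
      _ ≤ Real.exp (-n) := by
          rw [Real.exp_le_exp, neg_le_neg_iff]
          exact le_mul_of_one_le_right (Nat.cast_nonneg _)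
            (by exact_mod_cast (Finset.mem_Icc.1 K.2).1)
  have h5 : n * Real.exp (-n) ≤ 1 := by
    rw [Real.exp_neg, ← div_eq_mul_inv, div_le_one (Real.exp_pos _)]
    have := Real.add_one_le_exp (n : ℝ)
    linarith
  have h6 : {ω | ∃ p : ClusteringCode n, ∃ X ∈ testMatrices p.2.1 p.2.2 (Q p),
      noiseLevel n p.1 t * ‖X‖ < frobInner (noise (A ω) P) X} =
      ⋃ p ∈ (Finset.univ : Finset (ClusteringCode n)), ⋃ X ∈ testMatrices p.2.1 p.2.2 (Q p),
        {ω | noiseLevel n p.1 t * ‖X‖ < frobInner (noise (A ω) P) X} := by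
    ext ω; simp
  rw [h6]
  calc _ ≤ ∑ p : ClusteringCode n, Real.exp (-(3 * n * (p.1 : ℕ))) * Real.exp (-t) :=
        (measureReal_biUnion_finset_le _ _).trans (Finset.sum_le_sum fun p _ => h1 p)
    _ = (∑ K : Finset.Icc 1 n, ∑ _q : (Fin n → Fin K.1) × (Fin n → Fin K.1),
          Real.exp (-(3 * n * (K : ℕ)))) * Real.exp (-t) := by
        rw [← Finset.sum_mul, Fintype.sum_sigma]
    _ ≤ (∑ _K : Finset.Icc 1 n, Real.exp (-n)) * Real.exp (-t) := by
        gcongr with K; exact h2 K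
    _ ≤ 1 * Real.exp (-t) := by
        gcongr; simpa using h5
    _ = Real.exp (-t) := one_mul _

end UnionBound

/-! ### The oracle inequality -/

/-- The code of a clustering. -/
def NestedClustering.code {n : ℕ} (S : NestedClustering n) : ClusteringCode n :=
  ⟨⟨S.K, Finset.mem_Icc.2 ⟨S.one_le_K, S.K_le⟩⟩, S.metaOf, S.z⟩

/-- A best approximation of `P` among the matrices that are blockwise of rank one for the clustering
with code `p`, minus `P` itself; zero if no clustering has the code `p`. -/
def oracleError {n : ℕ} (P : Matrix (Fin n) (Fin n) ℝ) (p : ClusteringCode n) :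
    Matrix (Fin n) (Fin n) ℝ :=
  open Classical in
  if h : ∃ S : NestedClustering n, S.code = p then
    (h.choose.exists_isRankOneFit P).choose - P else 0

lemma exists_oracleError_code {n : ℕ} (P : Matrix (Fin n) (Fin n) ℝ) (S : NestedClustering n) :
    ∃ Q, S.IsBlockRankOne Q ∧ (∀ M, S.IsBlockRankOne M → ‖P - Q‖ ≤ ‖P - M‖) ∧
      oracleError P S.code = Q - P := by
  have h : ∃ S' : NestedClustering n, S'.code = S.code := ⟨S, rfl⟩
  have hiff : ∀ M, h.choose.IsBlockRankOne M ↔ S.IsBlockRankOne M := by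
    have h1 := h.choose_spec
    generalize h.choose = S' at h1
    intro M
    change (∃ U V, M = nestedRankOne S'.code.2.1 S'.code.2.2 U V) ↔
      (∃ U V, M = nestedRankOne S.code.2.1 S.code.2.2 U V)
    rw [h1]
  have hQ := (h.choose.exists_isRankOneFit P).choose_spec
  exact ⟨_, (hiff _).1 hQ.isBlockRankOne, fun M hM => hQ.norm_sub_le ((hiff M).2 hM),
    dif_pos h⟩

section Oracle

variable {n : ℕ} {A P T : Matrix (Fin n) (Fin n) ℝ} {S : NestedClustering n} {t : ℝ}

/-- If the noise is below its level on the test matrices of `S`, then it is so, up to a constant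
factor, in the direction `T - P` for every matrix `T` that is blockwise of rank one. With the best
approximation `Q` of `P`, one has `T - P = (T - Q) + (Q - P)`, where `T - Q` is the orthogonal sum
of two blockwise rank one matrices and `‖T - Q‖ ≤ 2 ‖T - P‖`. -/
lemma frobInner_noise_sub_le
    (h : ∀ X ∈ testMatrices S.metaOf S.z (oracleError P S.code),
      frobInner (noise A P) X ≤ noiseLevel n S.K t * ‖X‖)
    (hT : S.IsBlockRankOne T) :
    frobInner (noise A P) (T - P) ≤ 7 * noiseLevel n S.K t * ‖T - P‖ := by
  classical
  set s := noiseLevel n S.K t with hs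
  have hs0 : 0 ≤ s := Real.sqrt_nonneg _
  have hnet : ∀ U V, frobInner (noise A P) (nestedRankOne S.metaOf S.z U V) ≤
      2 * s * ‖nestedRankOne S.metaOf S.z U V‖ := by
    have : NeZero S.K := ⟨Nat.one_le_iff_ne_zero.1 S.one_le_K⟩
    have : NeZero n := ⟨Nat.one_le_iff_ne_zero.1 (S.one_le_K.trans S.K_le)⟩
    refine frobInner_nestedRankOne_le _ _ _ hs0 fun m hm m' hm' => h _ ?_
    simp only [Fintype.card_fin] at hm hm'
    exact Finset.mem_insert_of_mem (Finset.mem_image.2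
      ⟨(m, m'), Finset.mem_product.2 ⟨hm, hm'⟩, rfl⟩)
  obtain ⟨Q, ⟨U', V', rfl⟩, hQ, hQe⟩ := exists_oracleError_code P S
  have hbias : frobInner (noise A P) (nestedRankOne S.metaOf S.z U' V' - P) ≤ s * ‖T - P‖ := by
    have h1 := h _ (Finset.mem_insert_self _ _)
    rw [hQe] at h1
    refine h1.trans (mul_le_mul_of_nonneg_left ?_ hs0)
    rw [norm_sub_rev, norm_sub_rev T]
    exact hQ T hT
  have hdist : ‖T - nestedRankOne S.metaOf S.z U' V'‖ ≤ 2 * ‖T - P‖ := by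
    have h1 := norm_sub_le_norm_sub_add_norm_sub T P (nestedRankOne S.metaOf S.z U' V')
    have h2 := hQ T hT
    rw [norm_sub_rev P T] at h2
    linarith
  obtain ⟨U, V, rfl⟩ := hT
  obtain ⟨X, Y, W, W', hsum, hnorm⟩ := exists_orthogonal_split S.metaOf S.z U U' V V'
  set T := nestedRankOne S.metaOf S.z U V
  set Q := nestedRankOne S.metaOf S.z U' V'
  set M := nestedRankOne S.metaOf S.z X W
  set M' := nestedRankOne S.metaOf S.z Y W'
  -- by orthogonality even `√2 * ‖T - Q‖` is a bound
  have h3 : ‖M‖ + ‖M'‖ ≤ 3 / 2 * ‖T - Q‖ := by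
    refine le_of_sq_le_sq ?_ (by positivity)
    nlinarith [sq_nonneg (‖M‖ - ‖M'‖), sq_nonneg ‖M‖, sq_nonneg ‖M'‖]
  have h4 : frobInner (noise A P) (T - P) =
      frobInner (noise A P) M + frobInner (noise A P) M' + frobInner (noise A P) (Q - P) := by
    rw [← frobInner_add_right, ← frobInner_add_right, ← hsum, sub_add_sub_cancel]
  have h5 := hnet X W
  have h6 := hnet Y W'
  have h7 : 2 * s * (‖M‖ + ‖M'‖) ≤ 2 * s * (3 * ‖T - P‖) := by
    gcongr
    linarith
  rw [h4]
  linarith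

lemma norm_sub_sub_noise_sq_le (hA : ∀ i j, A i j = 0 ∨ A i j = 1)
    (hP : ∀ i j, P i j ∈ Set.Icc (0 : ℝ) 1) : ‖A - P - noise A P‖ ^ 2 ≤ n := by
  rw [frobenius_norm_sq]
  have h1 : ∀ i : Fin n, ∑ j, (A - P - noise A P) i j ^ 2 ≤ 1 := by
    intro i
    rw [Finset.sum_eq_single i]
    · simp only [noise, Matrix.sub_apply, Matrix.of_apply, if_true, sub_zero]
      have := hP i i
      rcases hA i i with h | h <;> rw [h] <;> nlinarith [this.1, this.2]
    · intro j _ hj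
      simp [noise, hj.symm]
    · simp
  refine (Finset.sum_le_sum fun i _ => h1 i).trans ?_
  simp

lemma mul_mul_le_penalty {Psi1 Psi2 Psi3 : ℝ} (h2 : 0 ≤ Psi2) (h3 : 0 ≤ Psi3)
    (n K L : ℕ) : Psi1 * n * K ≤ penalty Psi1 Psi2 Psi3 n K L := by
  have h4 : 0 ≤ Psi2 * (K : ℝ) ^ 2 * Real.log n := by
    have := Real.log_natCast_nonneg n
    positivity
  have h5 : 0 ≤ Psi3 * n * Real.log K := by
    have := Real.log_natCast_nonneg K
    positivity
  rw [penalty]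
  linarith

/-- On the event that the noise is below its level, the estimation error is bounded by the penalty
of the true clustering: the noise level of the selected clustering is absorbed by its penalty. -/
lemma norm_sub_sq_le_of_noise_le {Psi1 Psi2 Psi3 : ℝ} (hPsi1 : 12000 ≤ Psi1)
    (hPsi2 : 12000 ≤ Psi2) (hPsi3 : 12000 ≤ Psi3) {S' : NestedClustering n} (ht : 0 ≤ t)
    (hA : ∀ i j, A i j = 0 ∨ A i j = 1) (hP : ∀ i j, P i j ∈ Set.Icc (0 : ℝ) 1)
    (hP' : S'.IsBlockRankOne P) (hT : IsPenalizedEstimator Psi1 Psi2 Psi3 A S T)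
    (h : ∀ X ∈ testMatrices S.metaOf S.z (oracleError P S.code),
      frobInner (noise A P) X ≤ noiseLevel n S.K t * ‖X‖) :
    ‖T - P‖ ^ 2 ≤ 1000 * (penalty Psi1 Psi2 Psi3 n S'.K S'.L + t) := by
  have h1 := hT.norm_sub_sq_le hP'
  have h2 := frobInner_noise_sub_le h hT.1.isBlockRankOne
  have h3 : frobInner (A - P) (T - P) =
      frobInner (noise A P) (T - P) + frobInner (A - P - noise A P) (T - P) := by
    rw [← frobInner_add_left, add_sub_cancel]
  have h4 := frobInner_le_norm_mul_norm (A - P - noise A P) (T - P)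
  have h5 := norm_sub_sub_noise_sq_le hA hP
  have h6 : noiseLevel n S.K t ^ 2 = 2 * (29 * n * S.K + t) := Real.sq_sqrt (by positivity)
  have h7 := mul_mul_le_penalty (Psi1 := Psi1) (by linarith : 0 ≤ Psi2)
    (by linarith : 0 ≤ Psi3) n S.K S.L
  have h8 := mul_mul_le_penalty (Psi1 := Psi1) (by linarith : 0 ≤ Psi2)
    (by linarith : 0 ≤ Psi3) n S'.K S'.L
  have h9 : 12000 * n * (S.K : ℝ) ≤ Psi1 * n * S.K := by gcongr
  have h10 : 12000 * n * (S'.K : ℝ) ≤ Psi1 * n * S'.K := by gcongr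
  have h11 : (n : ℝ) ≤ n * S'.K :=
    le_mul_of_one_le_right (Nat.cast_nonneg _) (by exact_mod_cast S'.one_le_K)
  set N := ‖T - P‖
  set s := noiseLevel n S.K t
  set d := ‖A - P - noise A P‖
  -- both linear terms are split so that half of `N ^ 2` remains on the left; `196 * s ^ 2` is at
  -- most `12000 * n * S.K + 392 * t`
  have h12 : 0 ≤ (n : ℝ) * S.K := by positivity
  have h13 : 14 * s * N ≤ 1 / 4 * N ^ 2 + 196 * s ^ 2 := by nlinarith [sq_nonneg (N / 2 - 14 * s)]
  have h14 : 2 * d * N ≤ 1 / 4 * N ^ 2 + 4 * d ^ 2 := by nlinarith [sq_nonneg (N / 2 - 2 * d)]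
  linarith

/-- The crude bound on the estimation error that holds for every realization. -/
lemma norm_sub_le_of_isRankOneFit (hA : ∀ i j, A i j = 0 ∨ A i j = 1)
    (hT : IsRankOneFit A S T) : ‖T - P‖ ≤ 2 * n + ‖P‖ := by
  have h0 : S.IsBlockRankOne 0 := ⟨0, 0, by ext; simp [nestedRankOne_apply]⟩
  have h1 := hT.norm_sub_le h0
  rw [sub_zero] at h1
  have h2 : ‖A‖ ≤ n := by
    refine le_of_sq_le_sq ?_ (Nat.cast_nonneg n)
    rw [frobenius_norm_sq]
    calc ∑ i, ∑ j, A i j ^ 2 ≤ ∑ _i : Fin n, ∑ _j : Fin n, (1 : ℝ) := by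
          refine Finset.sum_le_sum fun i _ => Finset.sum_le_sum fun j _ => ?_
          rcases hA i j with h | h <;> simp [h]
      _ = (n : ℝ) ^ 2 := by simp [sq]
  have h3 := norm_sub_le T P
  have h4 := norm_sub_norm_le T A
  rw [norm_sub_rev] at h4
  linarith

end Oracle

/-! ### Expectations from tail bounds -/

/-- A random variable whose excess over `C * a` is larger than `C * t` with probability at most
`exp (-t)` has expectation at most `C * (a + 1)`. -/
lemma integral_le_of_exp_tail {Ω : Type*} [MeasurableSpace Ω] {μ : Measure Ω}
    [IsProbabilityMeasure μ] {X : Ω → ℝ} (hX : Integrable X μ) {C a : ℝ} (hC : 0 < C)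
    (h : ∀ t, 0 < t → μ.real {ω | C * (a + t) < X ω} ≤ Real.exp (-t)) :
    ∫ ω, X ω ∂μ ≤ C * (a + 1) := by
  have hY : Integrable (fun ω => max (X ω / C - a) 0) μ :=
    ((hX.div_const C).sub (integrable_const a)).sup (integrable_zero _ _ _)
  have h1 : ∫ ω, max (X ω / C - a) 0 ∂μ ≤ 1 := by
    rw [hY.integral_eq_integral_meas_lt (ae_of_all _ fun ω => le_max_right _ _),
      ← integral_exp_neg_Ioi_zero]
    refine integral_mono_of_nonneg (ae_of_all _ fun t => measureReal_nonneg)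
      (by simpa [IntegrableOn] using exp_neg_integrableOn_Ioi 0 one_pos) ?_
    refine (ae_restrict_iff' measurableSet_Ioi).2 (ae_of_all _ fun t (ht : 0 < t) => ?_)
    refine (measureReal_mono fun ω hω => ?_).trans (h t ht)
    rcases lt_max_iff.1 (Set.mem_ofPred_eq ▸ hω) with h2 | h2
    · have := (lt_div_iff₀ hC).1 (lt_sub_iff_add_lt.1 h2)
      change C * (a + t) < X ω
      linarith
    · exact absurd h2 ht.not_gt
  calc ∫ ω, X ω ∂μ ≤ ∫ ω, C * (a + max (X ω / C - a) 0) ∂μ := by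
        refine integral_mono hX (((integrable_const a).add hY).const_mul C) fun ω => ?_
        have h2 := le_max_left (X ω / C - a) 0
        have h3 : X ω = C * (a + (X ω / C - a)) := by field_simp; ring
        change X ω ≤ C * (a + max (X ω / C - a) 0)
        conv_lhs => rw [h3]
        gcongr
    _ = C * (a + ∫ ω, max (X ω / C - a) 0 ∂μ) := by
        rw [integral_const_mul, integral_add (integrable_const a) hY]; simp
    _ ≤ C * (a + 1) := by gcongr

end
theorem theorem2 :
    ∃ Psi0 : ℝ, 0 < Psi0 ∧
    ∀ Psi1 Psi2 Psi3 : ℝ, Psi0 ≤ Psi1 → Psi0 ≤ Psi2 → Psi0 ≤ Psi3 →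
    ∃ Ctilde : ℝ, 0 < Ctilde ∧
    ∀ (n : ℕ) (Sstar : NestedClustering n) (Pstar : Matrix (Fin n) (Fin n) ℝ)
      (Hstar : Matrix (Fin n) (Fin Sstar.L) ℝ) (lam0 : ℝ),
      IsNestedBlockModel Sstar Pstar Hstar →
      0 < lam0 → AssumptionA1 Sstar Pstar lam0 →
      AssumptionA2 Sstar Hstar →
    ∀ (Ω : Type*) (_ : MeasurableSpace Ω) (μ : Measure Ω) (_ : IsProbabilityMeasure μ)
      (A : Ω → Matrix (Fin n) (Fin n) ℝ)
      (Shat : Ω → NestedClustering n) (Phat : Ω → Matrix (Fin n) (Fin n) ℝ),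
      IsRandomAdjacency μ A Pstar →
      (∀ i j, Measurable fun ω => Phat ω i j) →
      (∀ ω, IsPenalizedEstimator Psi1 Psi2 Psi3 (A ω) (Shat ω) (Phat ω)) →
      (∀ t : ℝ, 0 < t →
        1 - 3 * Real.exp (-t) ≤
          μ.real {ω | ‖Phat ω - Pstar‖ ^ 2 ≤
            Ctilde * (penalty Psi1 Psi2 Psi3 n Sstar.K Sstar.L + t)}) ∧
      Integrable (fun ω => ‖Phat ω - Pstar‖ ^ 2) μ ∧
      ∫ ω, ‖Phat ω - Pstar‖ ^ 2 ∂μ ≤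
        Ctilde * (penalty Psi1 Psi2 Psi3 n Sstar.K Sstar.L + 3) := by

  refine ⟨12000, by norm_num, fun Psi1 Psi2 Psi3 h1 h2 h3 => ⟨1000, by norm_num, ?_⟩⟩
  intro n S P H _ hP _ _ _ Ω _ μ _ A Shat Phat hA hmeas hest
  have hP0 : ∀ i j, 0 ≤ P i j := fun i j => (hP.prob_mem i j).1
  have hmeas' : Measurable fun ω => ‖Phat ω - P‖ ^ 2 := by
    simp only [frobenius_norm_sq, Matrix.sub_apply]
    exact Finset.measurable_sum _ fun i _ => Finset.measurable_sum _ fun j _ =>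
      ((hmeas i j).sub_const _).pow_const 2
  have htail : ∀ t, 0 < t → μ.real {ω | 1000 * (penalty Psi1 Psi2 Psi3 n S.K S.L + t) <
      ‖Phat ω - P‖ ^ 2} ≤ Real.exp (-t) := by
    intro t ht
    refine (measureReal_mono fun ω hω => ?_).trans
      (hA.measureReal_exists_lt_frobInner_noise_le hP.symm hP0 (oracleError P) ht.le)
    by_contra hno
    simp only [Set.mem_ofPred_eq, not_exists, not_and, not_lt] at hno
    exact hω.not_ge (norm_sub_sq_le_of_noise_le h1 h2 h3 ht.le (hA.zero_or_one ω) hP.prob_mem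
      hP.isBlockRankOne (hest ω) (hno (Shat ω).code))
  have hint : Integrable (fun ω => ‖Phat ω - P‖ ^ 2) μ := by
    refine Integrable.of_bound hmeas'.aestronglyMeasurable ((2 * n + ‖P‖) ^ 2)
      (ae_of_all _ fun ω => ?_)
    rw [Real.norm_of_nonneg (sq_nonneg _)]
    exact pow_le_pow_left₀ (norm_nonneg _)
      (norm_sub_le_of_isRankOneFit (hA.zero_or_one ω) (hest ω).1) 2
  refine ⟨fun t ht => ?_, hint, ?_⟩
  · have h4 := htail t ht
    have h5 := probReal_compl_eq_one_sub (μ := μ) (measurableSet_le hmeas'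
      (measurable_const (a := 1000 * (penalty Psi1 Psi2 Psi3 n S.K S.L + t))))
    have h6 : {ω | ‖Phat ω - P‖ ^ 2 ≤ 1000 * (penalty Psi1 Psi2 Psi3 n S.K S.L + t)}ᶜ =
        {ω | 1000 * (penalty Psi1 Psi2 Psi3 n S.K S.L + t) < ‖Phat ω - P‖ ^ 2} := by
      ext ω; simp
    rw [h6] at h5
    linarith [Real.exp_pos (-t)]
  · exact (integral_le_of_exp_tail hint (by norm_num) htail).trans (by linarith)
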